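/- For linear subspaces $L, M$ of $\mathbb{R}^n$ with $\dim L+\dim M\le n$, let $[L,M]$ denote the subspace determinant, i.e. the $(\dim L+\dim M)$-dimensional volume of a parallelepiped spanned by the union of an orthonormal basis of $L$ and an orthonormal basis of $M$; for $\dim L+\dim M\ge n$ put $[L,M]=[L^\perp,M^\perp]$. For a vector $u$ write $[u,M]=[\operatorname{span}u,M]$. Let $G(n,p)$ be the set of all $p$-dimensional linear subspaces of $\mathbb{R}^n$, and for $u\in S^{n-1}$ let $G(\operatorname{span}u,q)$ be the set of all $q$-dimensional linear subspaces of $\mathbb{R}^n$ containing $u$, with its usual topology. Let $\nu_q^{\operatorname{span}u}$ be the probability measure on $G(\operatorname{span}u,q)$ that is invariant under all rotations of $\mathbb{R}^n$ fixing $u$, i.e. the distribution of $\rho L_0$, where $L_0\in G(\operatorname{span}u,q)$ is an arbitrary fixed subspace and $\rho$ is distributed according to the Haar probability measure on the group of all $\rho\in SO_n$ with $\rho u=u$. **Lemma.** Let $n\ge 2$, $\alpha\ge 0$ and $p,q\in\{1,\ldots,n-1\}$ with $p+q\le n$. Then, for every $u\in S^{n-1}$ and every $M\in G(n,p)$, the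 function $L\mapsto [L,M]^\alpha$ is $\nu_q^{\operatorname{span}u}$-integrable and $$\int_{G(\operatorname{span}u,\,q)}[L,M]^\alpha\,\nu_q^{\operatorname{span}u}(dL)=a(n,p,q,\alpha)\,[u,M]^\alpha,$$ where $$a(n,p,q,\alpha)=\prod_{i=1}^{p}\frac{\Gamma\!\left(\frac{n-i}{2}\right)\Gamma\!\left(\frac{n-q-i+\alpha+1}{2}\right)}{\Gamma\!\left(\frac{n-i+\alpha}{2}\right)\Gamma\!\left(\frac{n-q-i+1}{2}\right)},$$ and $0^0=1$ when $\alpha=0$. -/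

import Mathlib

open MeasureTheory

noncomputable section

/-- The `(dim L + dim M)`-dimensional volume of the parallelepiped spanned by the union of an
orthonormal basis of `L` and an orthonormal basis of `M`. -/
def spanVolume {n : ℕ} (L M : Submodule ℝ (EuclideanSpace ℝ (Fin n))) : ℝ :=
  (μHE[Module.finrank ℝ L + Module.finrank ℝ M]).real
    (parallelepiped (Sum.elim
      (fun i => (stdOrthonormalBasis ℝ L i : EuclideanSpace ℝ (Fin n)))
      (fun j => (stdOrthonormalBasis ℝ M j : EuclideanSpace ℝ (Fin n)))))

/-- The subspace determinant `[L, M]`: the above volume if `dim L + dim M ≤ n`, and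
`[Lᗮ, Mᗮ]` otherwise. -/
def subspaceDet {n : ℕ} (L M : Submodule ℝ (EuclideanSpace ℝ (Fin n))) : ℝ :=
  if Module.finrank ℝ L + Module.finrank ℝ M ≤ n then spanVolume L M else spanVolume Lᗮ Mᗮ

/-- The relative Grassmannian `G(N, q)` of all `q`-dimensional linear subspaces of `ℝⁿ`
containing the linear subspace `N`. -/
def RelGrassmannian {n : ℕ} (N : Submodule ℝ (EuclideanSpace ℝ (Fin n))) (q : ℕ) : Type :=
  {L : Submodule ℝ (EuclideanSpace ℝ (Fin n)) // N ≤ L ∧ Module.finrank ℝ L = q}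

/-- The usual topology of the Grassmannian, given by the distance `‖P_L - P_L'‖` of orthogonal
projections. -/
instance {n : ℕ} (N : Submodule ℝ (EuclideanSpace ℝ (Fin n))) (q : ℕ) :
    TopologicalSpace (RelGrassmannian N q) :=
  TopologicalSpace.induced (fun L => L.1.starProjection) inferInstance

instance {n : ℕ} (N : Submodule ℝ (EuclideanSpace ℝ (Fin n))) (q : ℕ) :
    MeasurableSpace (RelGrassmannian N q) := borel _

instance {n : ℕ} (N : Submodule ℝ (EuclideanSpace ℝ (Fin n))) (q : ℕ) :
    BorelSpace (RelGrassmannian N q) := ⟨rfl⟩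

/-- The group of all rotations (orthogonal maps of determinant one) of `ℝⁿ` that fix every
vector of the subspace `N`. -/
def rotationsFixing {n : ℕ} (N : Submodule ℝ (EuclideanSpace ℝ (Fin n))) :
    Subgroup (unitary (EuclideanSpace ℝ (Fin n) →L[ℝ] EuclideanSpace ℝ (Fin n))) where
  carrier := {ρ | ρ.1.det = 1 ∧ ∀ x ∈ N, ρ.1 x = x}
  one_mem' := by
    simp [ContinuousLinearMap.det]
  mul_mem' := by
    rintro a b ⟨ha, ha'⟩ ⟨hb, hb'⟩
    refine ⟨?_, fun x hx => ?_⟩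
    · have := LinearMap.det_comp (a.1 : EuclideanSpace ℝ (Fin n) →ₗ[ℝ] _) (b.1 : _ →ₗ[ℝ] _)
      simp only [ContinuousLinearMap.det] at *
      rw [ha, hb] at this
      simpa using this
    · change a.1 (b.1 x) = x
      rw [hb' x hx, ha' x hx]
  inv_mem' := by
    rintro a ⟨ha, ha'⟩
    have h1 : ((a⁻¹ : unitary _).1 * a.1) = 1 := by
      have := congrArg Subtype.val (inv_mul_cancel a)
      exact this
    refine ⟨?_, fun x hx => ?_⟩
    · have := LinearMap.det_comp ((a⁻¹ : unitary _).1 : EuclideanSpace ℝ (Fin n) →ₗ[ℝ] _)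
        (a.1 : _ →ₗ[ℝ] _)
      simp only [ContinuousLinearMap.det] at *
      rw [ha, mul_one] at this
      rw [← this]
      change LinearMap.det (((a⁻¹ : unitary _).1 * a.1 :
        EuclideanSpace ℝ (Fin n) →L[ℝ] EuclideanSpace ℝ (Fin n)) :
          EuclideanSpace ℝ (Fin n) →ₗ[ℝ] EuclideanSpace ℝ (Fin n)) = 1
      rw [h1]
      simp
    · have := DFunLike.congr_fun h1 x
      change (a⁻¹ : unitary _).1 (a.1 x) = x at this
      rwa [ha' x hx] at this

instance {n : ℕ} :
    ContinuousStar (EuclideanSpace ℝ (Fin n) →L[ℝ] EuclideanSpace ℝ (Fin n)) :=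
  ⟨(ContinuousLinearMap.adjoint (𝕜 := ℝ) (E := EuclideanSpace ℝ (Fin n))
    (F := EuclideanSpace ℝ (Fin n))).continuous⟩

instance {n : ℕ} (N : Submodule ℝ (EuclideanSpace ℝ (Fin n))) :
    MeasurableSpace (rotationsFixing N) := borel _

instance {n : ℕ} (N : Submodule ℝ (EuclideanSpace ℝ (Fin n))) :
    BorelSpace (rotationsFixing N) := ⟨rfl⟩

instance {n : ℕ} (N : Submodule ℝ (EuclideanSpace ℝ (Fin n))) :
    CompactSpace (rotationsFixing N) := by
  have hemb : Topology.IsClosedEmbedding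
      (fun ρ : rotationsFixing N =>
        (ρ.1.1 : EuclideanSpace ℝ (Fin n) →L[ℝ] EuclideanSpace ℝ (Fin n))) := by
    refine ⟨Topology.IsEmbedding.subtypeVal.comp Topology.IsEmbedding.subtypeVal, ?_⟩
    have hr : Set.range (fun ρ : rotationsFixing N =>
        (ρ.1.1 : EuclideanSpace ℝ (Fin n) →L[ℝ] EuclideanSpace ℝ (Fin n))) =
        (unitary (EuclideanSpace ℝ (Fin n) →L[ℝ] EuclideanSpace ℝ (Fin n)) : Set _) ∩
          ({A | A.det = 1} ∩ ⋂ x ∈ N, {A | A x = x}) := by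
      ext A
      constructor
      · rintro ⟨ρ, rfl⟩
        exact ⟨ρ.1.2, ρ.2.1, by simpa using ρ.2.2⟩
      · rintro ⟨h1, h2, h3⟩
        exact ⟨⟨⟨A, h1⟩, h2, by simpa using h3⟩, rfl⟩
    rw [hr]
    refine isClosed_unitary.inter (IsClosed.inter ?_ ?_)
    · exact isClosed_eq ContinuousLinearMap.continuous_det continuous_const
    · refine isClosed_biInter fun x _ => isClosed_eq ?_ continuous_const
      exact continuous_eval_const x
  rw [← isCompact_univ_iff, hemb.isCompact_iff]
  refine (isCompact_closedBall
    (0 : EuclideanSpace ℝ (Fin n) →L[ℝ] EuclideanSpace ℝ (Fin n)) 1).of_isClosed_subset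
    (hemb.isClosedMap _ isClosed_univ) ?_
  rintro _ ⟨ρ, -, rfl⟩
  rw [mem_closedBall_zero_iff]
  refine ContinuousLinearMap.opNorm_le_bound _ zero_le_one fun x => ?_
  rw [one_mul]
  exact (ContinuousLinearMap.norm_map_of_mem_unitary ρ.1.2 x).le

/-- The invariant (Haar) probability measure on the group of rotations fixing `N`. -/
def rotationHaar {n : ℕ} (N : Submodule ℝ (EuclideanSpace ℝ (Fin n))) :
    Measure (rotationsFixing N) :=
  Measure.haarMeasure ⊤

/-- The image `ρ L` of `L ∈ G(N, q)` under a rotation `ρ` fixing `N`. -/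
def RelGrassmannian.rotate {n : ℕ} {N : Submodule ℝ (EuclideanSpace ℝ (Fin n))} {q : ℕ}
    (ρ : rotationsFixing N) (L : RelGrassmannian N q) : RelGrassmannian N q :=
  ⟨L.1.map (ρ.1.1 : EuclideanSpace ℝ (Fin n) →ₗ[ℝ] EuclideanSpace ℝ (Fin n)),
    fun x hx => ⟨x, L.2.1 hx, ρ.2.2 x hx⟩, by
      refine (LinearEquiv.finrank_eq (Submodule.equivMapOfInjective _ ?_ L.1)).symm.trans L.2.2
      exact (Unitary.linearIsometryEquiv ρ.1).injective⟩

/-- The invariant probability measure `ν_q^N` on `G(N, q)`: the image of the Haar probability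
measure on the rotations fixing `N` under `ρ ↦ ρ L₀`, where `L₀ ∈ G(N, q)` is an (arbitrary)
reference subspace. -/
def invariantMeasure {n : ℕ} {N : Submodule ℝ (EuclideanSpace ℝ (Fin n))} {q : ℕ}
    (L₀ : RelGrassmannian N q) : Measure (RelGrassmannian N q) :=
  (rotationHaar N).map (fun ρ => RelGrassmannian.rotate ρ L₀)

theorem RelGrassmannian.continuous_rotate {n : ℕ}
    {N : Submodule ℝ (EuclideanSpace ℝ (Fin n))} {q : ℕ} :
    Continuous (fun x : rotationsFixing N × RelGrassmannian N q =>
      RelGrassmannian.rotate x.1 x.2) := by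
  have h : ∀ x : rotationsFixing N × RelGrassmannian N q,
      (RelGrassmannian.rotate x.1 x.2).1.starProjection =
        (x.1.1.1 * x.2.1.starProjection) * star x.1.1.1 := by
    rintro ⟨ρ, L⟩
    ext1 y
    have h1 := Submodule.starProjection_map_apply (Unitary.linearIsometryEquiv ρ.1) L.1 y
    exact h1
  refine continuous_induced_rng.2 ?_
  have h0 : Continuous fun L : RelGrassmannian N q => L.1.starProjection :=
    continuous_induced_dom
  have h2 : Continuous fun x : rotationsFixing N × RelGrassmannian N q =>
      x.2.1.starProjection := h0.comp continuous_snd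
  have h3 : Continuous fun x : rotationsFixing N × RelGrassmannian N q => x.1.1.1 :=
    continuous_subtype_val.comp (continuous_subtype_val.comp continuous_fst)
  exact ((h3.mul h2).mul h3.star).congr fun x => (h x).symm

instance {n : ℕ} (N : Submodule ℝ (EuclideanSpace ℝ (Fin n))) :
    IsProbabilityMeasure (rotationHaar N) :=
  ⟨Measure.haarMeasure_self (K₀ := (⊤ : TopologicalSpace.PositiveCompacts (rotationsFixing N)))⟩

instance {n : ℕ} {N : Submodule ℝ (EuclideanSpace ℝ (Fin n))} {q : ℕ}
    (L₀ : RelGrassmannian N q) : IsProbabilityMeasure (invariantMeasure L₀) :=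
  Measure.isProbabilityMeasure_map
    (RelGrassmannian.continuous_rotate.comp (Continuous.prodMk_left L₀)).measurable.aemeasurable

/-- `ν_q^N` is invariant under all rotations fixing `N`. -/
theorem invariantMeasure_map_rotate {n : ℕ} {N : Submodule ℝ (EuclideanSpace ℝ (Fin n))} {q : ℕ}
    (L₀ : RelGrassmannian N q) (σ : rotationsFixing N) :
    (invariantMeasure L₀).map (RelGrassmannian.rotate σ) = invariantMeasure L₀ := by
  have h1 : Measurable fun ρ : rotationsFixing N => RelGrassmannian.rotate ρ L₀ :=
    (RelGrassmannian.continuous_rotate.comp (Continuous.prodMk_left L₀)).measurable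
  have h2 : Measurable fun L : RelGrassmannian N q => RelGrassmannian.rotate σ L :=
    (RelGrassmannian.continuous_rotate.comp (Continuous.prodMk_right σ)).measurable
  have h3 : Measurable fun ρ : rotationsFixing N => σ * ρ := (continuous_const_mul σ).measurable
  have h4 : (rotationHaar N).map (fun ρ => σ * ρ) = rotationHaar N := by
    unfold rotationHaar
    exact map_mul_left_eq_self _ σ
  unfold invariantMeasure
  rw [Measure.map_map h2 h1]
  conv_rhs => rw [← h4, Measure.map_map h1 h3]
  congr 1
  funext ρ
  exact Subtype.ext (Submodule.map_comp _ _ L₀.1).symm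

/-- The constant `a(n, p, q, α)`. -/
def aConst (n p q : ℕ) (α : ℝ) : ℝ :=
  ∏ i ∈ Finset.Icc 1 p,
    (Real.Gamma (((n : ℝ) - i) / 2) * Real.Gamma (((n : ℝ) - q - i + α + 1) / 2)) /
      (Real.Gamma (((n : ℝ) - i + α) / 2) * Real.Gamma (((n : ℝ) - q - i + 1) / 2))

end

/-!
The subspace determinant `[L, M]` is the `p`-dimensional volume (square root of a Gram determinant)
of the projection to `Lᗮ` of an orthonormal basis `m` of `M`; this is base times height
(`gramVol_sumElim`), together with the area formula for linear maps. So the integral is the mean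
`Φ(m)` over `L` of the `α`-th power of the volume of the projection of the frame `m` to `Lᗮ`
(`projMean`), and `Φ` makes sense for arbitrary families `m` of `p` vectors.

Since every `L` contains `u`, only the projection `m'` of `m` to `uᗮ` matters. A change of basis `T`
multiplies `Φ` by `|det T| ^ α`, and the rotations fixing `u` act transitively, up to signs, on
orthonormal frames in `uᗮ`. Hence `Φ(m) = Φ₀ * vol(m') ^ α` with a constant `Φ₀`
(`projMean_eq_mul`), and `vol(m') = [u, M]` when `m` is an orthonormal basis of `M`.

To find `Φ₀`, take for `m` independent standard Gaussian vectors and exchange the order of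
integration (`projMean_orthonormal`). For any `k`-dimensional subspace `K`, the `α`-th moment of the
volume of the projections of `p` Gaussian vectors to `K` is the product over `i < p` of the `α`-th
moments of the norm of a Gaussian vector in dimension `k - i`
(`lintegral_gramVol_starProjection_pi_stdGaussian`). With `k = n - q` for `Lᗮ` and `k = n - 1` for
`uᗮ`, the quotient of the two products is `a(n, p, q, α)`.

For `α = 0` both sides are `1`. The rest assumes `α > 0`, so that dependent families, whose volume
is `0`, contribute `0 ^ α = 0` and need no separate null-set argument.
-/

/-! ### Gram determinants and volumes of parallelepipeds -/

section GramVolume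

variable {E : Type*} [NormedAddCommGroup E] [InnerProductSpace ℝ E]
variable {ι κ : Type*} [Fintype ι] [DecidableEq ι] [Fintype κ] [DecidableEq κ]

/-- The volume of the parallelepiped spanned by a finite family of vectors, as the square root of
the Gram determinant. It vanishes exactly on linearly dependent families. -/
noncomputable def gramVol (v : ι → E) : ℝ := √(Matrix.gram ℝ v).det

theorem gramVol_nonneg (v : ι → E) : 0 ≤ gramVol v := Real.sqrt_nonneg _

theorem gramVol_ne_zero_iff {v : ι → E} : gramVol v ≠ 0 ↔ LinearIndependent ℝ v := by
  rw [gramVol, Real.sqrt_ne_zero (Matrix.posSemidef_gram ℝ v).det_nonneg,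
    Matrix.det_gram_ne_zero_iff_linearIndependent]

theorem gramVol_orthonormal {v : ι → E} (hv : Orthonormal ℝ v) : gramVol v = 1 := by
  rw [gramVol, Matrix.gram_eq_one_iff_orthonormal.2 hv]
  simp

theorem gramVol_comp_equiv (v : ι → E) (e : κ ≃ ι) : gramVol (v ∘ e) = gramVol v := by
  rw [gramVol, gramVol, ← Matrix.det_submatrix_equiv_self e (Matrix.gram ℝ v)]
  rfl

theorem gramVol_unique [Unique ι] (v : ι → E) : gramVol v = ‖v default‖ := by
  rw [gramVol, Matrix.det_unique, Matrix.gram_apply, real_inner_self_eq_norm_sq,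
    Real.sqrt_sq (norm_nonneg _)]

theorem gramVol_congr {F : Type*} [NormedAddCommGroup F] [InnerProductSpace ℝ F]
    {v : ι → E} {w : ι → F} (h : ∀ i j, inner ℝ (v i) (v j) = inner ℝ (w i) (w j)) :
    gramVol v = gramVol w := by
  have : Matrix.gram ℝ v = Matrix.gram ℝ w := Matrix.ext h
  rw [gramVol, gramVol, this]

theorem gramVol_sum_smul (v : ι → E) (T : Matrix ι ι ℝ) :
    gramVol (fun j => ∑ i, T i j • v i) = |T.det| * gramVol v := by
  have h : Matrix.gram ℝ (fun j => ∑ i, T i j • v i) = T.transpose * Matrix.gram ℝ v * T := by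
    ext j k
    simp only [Matrix.gram_apply, sum_inner, inner_sum, real_inner_smul_left,
      real_inner_smul_right, Matrix.mul_apply, Matrix.transpose_apply, Finset.sum_mul]
    exact Finset.sum_congr rfl fun _ _ => Finset.sum_congr rfl fun _ _ => by ring
  rw [gramVol, h, Matrix.det_mul, Matrix.det_mul, Matrix.det_transpose,
    show T.det * (Matrix.gram ℝ v).det * T.det = T.det ^ 2 * (Matrix.gram ℝ v).det by ring,
    Real.sqrt_mul (sq_nonneg _), Real.sqrt_sq_eq_abs, gramVol]

theorem gramVol_sumElim_of_inner_eq_zero (l : κ → E) (w : ι → E)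
    (h : ∀ k i, inner ℝ (l k) (w i) = 0) : gramVol (Sum.elim l w) = gramVol l * gramVol w := by
  have : Matrix.gram ℝ (Sum.elim l w) =
      Matrix.fromBlocks (Matrix.gram ℝ l) 0 0 (Matrix.gram ℝ w) := by
    ext (i | i) (j | j)
    · simp
    · simp [h]
    · simp [real_inner_comm, h]
    · simp
  rw [gramVol, this, Matrix.det_fromBlocks_zero₂₁,
    Real.sqrt_mul (Matrix.posSemidef_gram ℝ l).det_nonneg, gramVol, gramVol]

/-- Base times height: removing from each `l k` its component in the span of `w` is a unipotent
change of the family `(l, w)`, which makes the Gram matrix block diagonal. -/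
theorem gramVol_sumElim [FiniteDimensional ℝ E] (l : κ → E) (w : ι → E) :
    gramVol (Sum.elim l w) =
      gramVol (fun k => (Submodule.span ℝ (Set.range w))ᗮ.starProjection (l k)) * gramVol w := by
  set S := Submodule.span ℝ (Set.range w) with hS
  have hmem : ∀ k, ∃ c : ι → ℝ, ∑ i, c i • w i = S.starProjection (l k) := fun k =>
    (Submodule.mem_span_range_iff_exists_fun ℝ).1 (S.starProjection_apply_mem (l k))
  choose c hc using hmem
  have h1 : Sum.elim l w = fun j => ∑ i, (Matrix.fromBlocks (1 : Matrix κ κ ℝ) 0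
      (Matrix.of fun i k => c k i) (1 : Matrix ι ι ℝ)) i j •
        Sum.elim (fun k => Sᗮ.starProjection (l k)) w i := by
    funext j
    rcases j with k | i
    · simp only [Sum.elim_inl, Fintype.sum_sum_type, Matrix.fromBlocks_apply₁₁,
        Matrix.fromBlocks_apply₂₁, Sum.elim_inr, Matrix.of_apply, hc]
      simp [Matrix.one_apply, add_comm]
    · simp [Fintype.sum_sum_type, Matrix.one_apply]
  rw [h1, gramVol_sum_smul, Matrix.det_fromBlocks_zero₁₂, gramVol_sumElim_of_inner_eq_zero]
  · simp
  · intro k i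
    exact Submodule.inner_left_of_mem_orthogonal (Submodule.subset_span (Set.mem_range_self i))
      (Sᗮ.starProjection_apply_mem (l k))

theorem starProjection_orthogonal_comp_of_le [FiniteDimensional ℝ E] {S K : Submodule ℝ E}
    (h : S ≤ K) (x : E) :
    Sᗮ.starProjection (K.starProjection x) = (Sᗮ ⊓ K).starProjection x := by
  have hy := K.starProjection_apply_mem x
  have hs := S.starProjection_apply_mem (K.starProjection x)
  have heq : Sᗮ.starProjection (K.starProjection x) =
      K.starProjection x - S.starProjection (K.starProjection x) := by
    simp [Submodule.starProjection_orthogonal]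
  refine (Submodule.eq_starProjection_of_mem_of_inner_eq_zero (K := Sᗮ ⊓ K)
    ⟨Sᗮ.starProjection_apply_mem _, ?_⟩ fun w hw => ?_).symm
  · rw [heq]
    exact K.sub_mem hy (h hs)
  · rw [heq, inner_sub_left, inner_sub_left,
      Submodule.inner_right_of_mem_orthogonal hs hw.1]
    have := K.starProjection_inner_eq_zero x w hw.2
    rw [inner_sub_left] at this
    linarith

theorem continuous_gramVol : Continuous (gramVol : (ι → E) → ℝ) := by
  unfold gramVol
  refine Real.continuous_sqrt.comp (Continuous.matrix_det ?_)
  exact continuous_matrix fun i j => (continuous_apply i).inner (continuous_apply j)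

/-- The `(card ι)`-dimensional Euclidean Hausdorff measure of a parallelepiped is the square root
of its Gram determinant; both vanish for dependent families. -/
theorem euclideanHausdorffMeasure_real_parallelepiped [MeasurableSpace E] [BorelSpace E]
    (v : ι → E) : (μHE[Fintype.card ι]).real (parallelepiped v) = gramVol v := by
  set b := EuclideanSpace.basisFun ι ℝ
  set f : EuclideanSpace ℝ ι →ₗ[ℝ] E := b.toBasis.constr ℝ v
  have hf : ∀ i, f (b i) = v i := fun i => by
    have h := b.toBasis.constr_basis ℝ v i
    rwa [b.coe_toBasis] at h
  have h1 : parallelepiped v = f '' parallelepiped b := by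
    rw [image_parallelepiped]
    congr 1
    funext i
    exact (hf i).symm
  have h2 := f.euclideanHausdorffMeasure_image_eq_normDet_mul_volume (parallelepiped b)
  rw [finrank_euclideanSpace] at h2
  rw [h1, Measure.real, h2, b.volume_parallelepiped, mul_one,
    ENNReal.toReal_ofReal f.normDet_nonneg]
  have h3 := f.normDet_sq_eq_det_gram b
  simp only [hf] at h3
  rw [gramVol, ← Real.sqrt_sq f.normDet_nonneg]
  exact congrArg Real.sqrt h3

end GramVolume


/-! ### Moments of Gaussian vectors and of their projections -/

section Gaussian

open ProbabilityTheory Real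

variable {F : Type*} [NormedAddCommGroup F] [InnerProductSpace ℝ F] [FiniteDimensional ℝ F]
  [MeasurableSpace F] [BorelSpace F]

/-- The density of the standard Gaussian measure, identified through its characteristic function. -/
theorem stdGaussian_eq_withDensity :
    stdGaussian F = (volume : Measure F).withDensity fun x =>
      ENNReal.ofReal ((2 * π) ^ (-(Module.finrank ℝ F : ℝ) / 2) * exp (-‖x‖ ^ 2 / 2)) := by
  set c : ℝ := (2 * π) ^ (-(Module.finrank ℝ F : ℝ) / 2) with hc
  have hc0 : 0 < c := by positivity
  have hcc : ((2 * π : ℂ) ^ (Module.finrank ℝ F / 2 : ℂ)) * (c : ℂ) = 1 := by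
    have h1 : c = ((2 * π) ^ ((Module.finrank ℝ F : ℝ) / 2))⁻¹ := by
      rw [hc, neg_div, rpow_neg (by positivity)]
    have h2 : ((2 * π : ℂ) ^ (Module.finrank ℝ F / 2 : ℂ)) =
        (((2 * π) ^ ((Module.finrank ℝ F : ℝ) / 2) : ℝ) : ℂ) := by
      rw [Complex.ofReal_cpow (by positivity)]
      push_cast
      rfl
    rw [h2, h1]
    norm_cast
    exact mul_inv_cancel₀ (by positivity)
  have hint : ∀ t : F, ∫ x : F, Complex.exp (inner ℝ x t * Complex.I) *
      ((c * exp (-‖x‖ ^ 2 / 2) : ℝ) : ℂ) = Complex.exp (-‖t‖ ^ 2 / 2) := by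
    intro t
    have h := GaussianFourier.integral_cexp_neg_mul_sq_norm_add (V := F) (b := 1 / 2)
      (by norm_num) Complex.I t
    have h3 : ∀ x : F, Complex.exp (inner ℝ x t * Complex.I) *
        ((c * exp (-‖x‖ ^ 2 / 2) : ℝ) : ℂ) =
        Complex.exp (-(1 / 2) * ‖x‖ ^ 2 + Complex.I * inner ℝ t x) * c := by
      intro x
      rw [Complex.exp_add, real_inner_comm x t]
      push_cast
      rw [show (-(‖x‖ : ℂ) ^ 2 / 2) = -(1 / 2) * ‖x‖ ^ 2 by ring, mul_comm Complex.I]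
      ring
    simp_rw [h3]
    rw [integral_mul_const, h, show (π : ℂ) / (1 / 2) = 2 * π by ring, mul_right_comm, hcc,
      one_mul, Complex.I_sq]
    congr 1
    ring
  have hm : Measurable fun x : F => c * exp (-‖x‖ ^ 2 / 2) := by fun_prop
  have hpos : ∀ x : F, 0 ≤ c * exp (-‖x‖ ^ 2 / 2) := fun x => by positivity
  -- were the density not integrable, its junk integral `0` would contradict `hint 0`
  have hcint : Integrable (fun x : F => c * exp (-‖x‖ ^ 2 / 2)) := by
    by_contra hni
    have h0 := hint 0
    simp only [inner_zero_right, Complex.ofReal_zero, zero_mul, Complex.exp_zero, one_mul,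
      integral_complex_ofReal, integral_undef hni] at h0
    simp at h0
  have hfin : IsFiniteMeasure ((volume : Measure F).withDensity fun x =>
      ENNReal.ofReal (c * exp (-‖x‖ ^ 2 / 2))) :=
    isFiniteMeasure_withDensity_ofReal hcint.2
  refine Measure.ext_of_charFun ?_
  funext t
  rw [charFun_stdGaussian, charFun_apply, integral_withDensity_eq_integral_toReal_smul
    hm.ennreal_ofReal (by simp), ← hint t]
  refine integral_congr_ae (.of_forall fun x => ?_)
  simp only [ENNReal.toReal_ofReal (hpos x), Complex.real_smul]
  ring

/-- The absolute moment of order `α` of the norm of a standard Gaussian vector in dimension `d`. -/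
noncomputable def gaussianNormMoment (α d : ℝ) : ℝ :=
  2 ^ (α / 2) * Gamma ((d + α) / 2) / Gamma (d / 2)

theorem gaussianNormMoment_pos {α d : ℝ} (hα : 0 ≤ α) (hd : 0 < d) :
    0 < gaussianNormMoment α d := by
  have h1 : 0 < Gamma ((d + α) / 2) := Gamma_pos_of_pos (by positivity)
  have h2 : 0 < Gamma (d / 2) := Gamma_pos_of_pos (by positivity)
  unfold gaussianNormMoment
  positivity

theorem integral_norm_rpow_stdGaussian {α : ℝ} (hα : 0 ≤ α) (hF : 0 < Module.finrank ℝ F) :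
    ∫ x, ‖x‖ ^ α ∂stdGaussian F = gaussianNormMoment α (Module.finrank ℝ F) := by
  set d := Module.finrank ℝ F with hd
  have hnt : Nontrivial F := Module.finrank_pos_iff.1 hF
  have hd0 : (0 : ℝ) < d := by exact_mod_cast hF
  have hd1 : (1 : ℝ) ≤ d := by exact_mod_cast hF
  set c : ℝ := (2 * π) ^ (-(d : ℝ) / 2) with hc
  have hc0 : 0 < c := by positivity
  set A : ℝ := c * (d * (volume : Measure F).real (Metric.ball 0 1)) with hA
  -- Polar coordinates; the common factor `A` is then eliminated by the case `β = 0`, where the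
  -- integral is `1`.
  have key : ∀ β : ℝ, 0 ≤ β → ∫ x, ‖x‖ ^ β ∂stdGaussian F =
      A * ((1 / 2) ^ (-(d + β) / 2) * (1 / 2) * Gamma ((d + β) / 2)) := by
    intro β hβ
    rw [stdGaussian_eq_withDensity, integral_withDensity_eq_integral_toReal_smul
      (by fun_prop) (by simp)]
    have h1 : ∀ x : F, (ENNReal.ofReal (c * exp (-‖x‖ ^ 2 / 2))).toReal • ‖x‖ ^ β =
        c * (fun r : ℝ => exp (-(1 / 2) * r ^ (2 : ℝ)) * r ^ β) ‖x‖ := by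
      intro x
      rw [ENNReal.toReal_ofReal (by positivity), smul_eq_mul]
      simp only [rpow_two]
      rw [show -‖x‖ ^ 2 / 2 = -(1 / 2) * ‖x‖ ^ 2 by ring]
      ring
    simp_rw [← hd, ← hc, h1]
    rw [integral_const_mul, integral_fun_norm_addHaar volume
      (fun r : ℝ => exp (-(1 / 2) * r ^ (2 : ℝ)) * r ^ β)]
    have h2 : ∫ y in Set.Ioi (0 : ℝ), y ^ (Module.finrank ℝ F - 1) •
        (exp (-(1 / 2) * y ^ (2 : ℝ)) * y ^ β) =
        ∫ y in Set.Ioi (0 : ℝ), y ^ ((d : ℝ) - 1 + β) * exp (-(1 / 2) * y ^ (2 : ℝ)) := by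
      refine setIntegral_congr_fun measurableSet_Ioi fun y hy => ?_
      have hy : 0 < y := hy
      simp only [smul_eq_mul]
      rw [rpow_add hy, ← hd, ← rpow_natCast, Nat.cast_sub hF, Nat.cast_one]
      ring
    rw [h2, integral_rpow_mul_exp_neg_mul_rpow two_pos (by linarith) (by norm_num),
      show (d : ℝ) - 1 + β + 1 = d + β by ring, hA, ← hd, nsmul_eq_mul, smul_eq_mul]
    ring
  have h0 := key 0 le_rfl
  simp only [rpow_zero, integral_const, probReal_univ, smul_eq_mul, mul_one, add_zero] at h0
  have hG : 0 < Gamma ((d : ℝ) / 2) := Gamma_pos_of_pos (by positivity)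
  rw [key α hα, gaussianNormMoment, eq_div_iff hG.ne']
  have h3 : ((1 : ℝ) / 2) ^ (-((d : ℝ) + α) / 2) = (1 / 2) ^ (-(d : ℝ) / 2) * 2 ^ (α / 2) := by
    rw [show -((d : ℝ) + α) / 2 = -(d : ℝ) / 2 + -(α / 2) by ring, rpow_add (by norm_num)]
    congr 1
    rw [one_div, inv_rpow (by norm_num), rpow_neg (by norm_num), inv_inv]
  rw [h3]
  linear_combination (-(2 ^ (α / 2) * Gamma ((d + α) / 2))) * h0

theorem lintegral_norm_rpow_stdGaussian {α : ℝ} (hα : 0 ≤ α) (hF : 0 < Module.finrank ℝ F) :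
    ∫⁻ x, ENNReal.ofReal (‖x‖ ^ α) ∂stdGaussian F =
      ENNReal.ofReal (gaussianNormMoment α (Module.finrank ℝ F)) := by
  have h := integral_norm_rpow_stdGaussian hα hF
  have hpos := gaussianNormMoment_pos hα (Nat.cast_pos.2 hF)
  rw [← h, ofReal_integral_eq_lintegral_ofReal]
  · exact .of_integral_ne_zero (h ▸ hpos.ne')
  · exact .of_forall fun x => by positivity

theorem stdGaussian_map_orthogonalProjection (W : Submodule ℝ F) :
    (stdGaussian F).map W.orthogonalProjectionOnto = stdGaussian W := by
  refine Measure.ext_of_charFun ?_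
  funext t
  rw [charFun_stdGaussian, charFun_apply, integral_map (by fun_prop) (by fun_prop)]
  have h : ∀ x : F, inner ℝ (W.orthogonalProjectionOnto x) t = inner ℝ x (t : F) := fun x => by
    simp
  simp_rw [h]
  rw [← charFun_apply, charFun_stdGaussian]
  simp

theorem lintegral_norm_starProjection_rpow_stdGaussian {α : ℝ} (hα : 0 ≤ α) (W : Submodule ℝ F)
    (hW : 0 < Module.finrank ℝ W) :
    ∫⁻ x, ENNReal.ofReal (‖W.starProjection x‖ ^ α) ∂stdGaussian F =
      ENNReal.ofReal (gaussianNormMoment α (Module.finrank ℝ W)) := by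
  rw [← lintegral_norm_rpow_stdGaussian hα hW, ← stdGaussian_map_orthogonalProjection,
    lintegral_map (by fun_prop) (by fun_prop)]
  rfl

/-- The moments of the volume spanned by the projections to `K` of independent standard Gaussian
vectors. Conditionally on the last `p` vectors, the first one contributes the norm of its
projection to a subspace of dimension `finrank K - p`. -/
theorem lintegral_gramVol_starProjection_pi_stdGaussian {α : ℝ} (hα : 0 < α) (K : Submodule ℝ F)
    (p : ℕ) (hp : p ≤ Module.finrank ℝ K) :
    ∫⁻ x : Fin p → F, ENNReal.ofReal (gramVol (fun i => K.starProjection (x i)) ^ α)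
        ∂Measure.pi (fun _ => stdGaussian F) =
      ENNReal.ofReal (∏ i ∈ Finset.range p,
        gaussianNormMoment α ((Module.finrank ℝ K : ℝ) - i)) := by
  induction p with
  | zero => simp [gramVol]
  | succ p ih =>
    have hcont : ∀ q : ℕ, Continuous fun x : Fin q → F =>
        gramVol (fun i => K.starProjection (x i)) := fun q =>
      continuous_gramVol.comp (continuous_pi fun i => by fun_prop)
    have hmeas : ∀ q : ℕ, Measurable fun x : Fin q → F =>
        ENNReal.ofReal (gramVol (fun i => K.starProjection (x i)) ^ α) := fun q =>
      ((hcont q).measurable.pow_const α).ennreal_ofReal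
    have hmp := (measurePreserving_piFinSuccAbove (fun _ : Fin (p + 1) => stdGaussian F) 0).symm
    have hmeas' := (hmeas (p + 1)).comp hmp.measurable
    rw [← hmp.lintegral_comp (hmeas _)]
    refine (lintegral_prod_symm _ hmeas'.aemeasurable).trans ?_
    have hnn : ∀ i ∈ Finset.range p,
        0 ≤ gaussianNormMoment α ((Module.finrank ℝ K : ℝ) - i) := fun i hi => by
      have h1 : ((i + 1 : ℕ) : ℝ) ≤ Module.finrank ℝ K := by
        exact_mod_cast (Nat.succ_le_of_lt (Finset.mem_range.1 hi)).trans (by omega)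
      push_cast at h1
      exact (gaussianNormMoment_pos hα.le (by linarith)).le
    rw [Finset.prod_range_succ, ENNReal.ofReal_mul (Finset.prod_nonneg hnn), ← ih (by omega),
      ← lintegral_mul_const _ (hmeas p)]
    refine lintegral_congr fun y => ?_
    set w : Fin p → F := fun i => K.starProjection (y i) with hw
    set S := Submodule.span ℝ (Set.range w) with hS
    have hSK : S ≤ K := by
      rw [hS, Submodule.span_le]
      rintro _ ⟨i, rfl⟩
      exact K.starProjection_apply_mem _
    have hbase : ∀ x : F, gramVol (fun i : Fin (p + 1) => K.starProjection
        ((MeasurableEquiv.piFinSuccAbove (fun _ => F) 0).symm (x, y) i)) =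
        ‖(Sᗮ ⊓ K).starProjection x‖ * gramVol w := by
      intro x
      have h1 : (fun i : Fin (p + 1) => K.starProjection
          ((MeasurableEquiv.piFinSuccAbove (fun _ => F) 0).symm (x, y) i)) =
          Sum.elim (fun _ : Unit => K.starProjection x) w ∘
            ((finSuccEquiv p).trans ((Equiv.optionEquivSumPUnit _).trans
              (Equiv.sumComm _ _))) := by
        funext i
        refine Fin.cases ?_ (fun i => ?_) i
        · simp [MeasurableEquiv.piFinSuccAbove]
        · simp [MeasurableEquiv.piFinSuccAbove, hw]
      rw [h1, gramVol_comp_equiv, gramVol_sumElim, gramVol_unique,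
        starProjection_orthogonal_comp_of_le hSK]
    change ∫⁻ x, ENNReal.ofReal (gramVol (fun i : Fin (p + 1) => K.starProjection
      ((MeasurableEquiv.piFinSuccAbove (fun _ => F) 0).symm (x, y) i)) ^ α) ∂stdGaussian F = _
    simp only [hbase]
    -- a dependent family `w` contributes `0` on both sides, since `0 ^ α = 0`
    by_cases h0 : gramVol w = 0
    · simp [h0, zero_rpow hα.ne']
    have hli := gramVol_ne_zero_iff.1 h0
    have hSdim : Module.finrank ℝ S = p := by
      simpa using finrank_span_eq_card hli
    have hdim : Module.finrank ℝ (Sᗮ ⊓ K : Submodule ℝ F) + p = Module.finrank ℝ K := by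
      have := Submodule.finrank_add_inf_finrank_orthogonal hSK
      omega
    have hdim' : (Module.finrank ℝ (Sᗮ ⊓ K : Submodule ℝ F) : ℝ) = Module.finrank ℝ K - p := by
      rw [← hdim]
      push_cast
      ring
    rw [← hdim', ← lintegral_norm_starProjection_rpow_stdGaussian hα.le _ (by omega),
      ← lintegral_const_mul' _ _ ENNReal.ofReal_ne_top]
    refine lintegral_congr fun x => ?_
    rw [mul_rpow (norm_nonneg _) (gramVol_nonneg _), mul_comm,
      ENNReal.ofReal_mul (rpow_nonneg (gramVol_nonneg _) _)]

end Gaussian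


/-! ### Averages over the relative Grassmannian -/

section Grassmannian

open ProbabilityTheory

variable {n : ℕ}

theorem subspaceDet_eq_gramVol (L M : Submodule ℝ (EuclideanSpace ℝ (Fin n)))
    (h : Module.finrank ℝ L + Module.finrank ℝ M ≤ n) :
    subspaceDet L M = gramVol fun j => Lᗮ.starProjection
      (stdOrthonormalBasis ℝ M j : EuclideanSpace ℝ (Fin n)) := by
  set l : Fin (Module.finrank ℝ L) → EuclideanSpace ℝ (Fin n) :=
    fun i => (stdOrthonormalBasis ℝ L i : EuclideanSpace ℝ (Fin n)) with hl
  set m : Fin (Module.finrank ℝ M) → EuclideanSpace ℝ (Fin n) :=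
    fun i => (stdOrthonormalBasis ℝ M i : EuclideanSpace ℝ (Fin n)) with hm
  have hlo : Orthonormal ℝ l :=
    (stdOrthonormalBasis ℝ L).orthonormal.comp_linearIsometry L.subtypeₗᵢ
  have hspan : Submodule.span ℝ (Set.range l) = L := by
    have h1 : Set.range l = L.subtype '' Set.range (stdOrthonormalBasis ℝ L) := by
      rw [← Set.range_comp]
      rfl
    have h2 := (stdOrthonormalBasis ℝ L).toBasis.span_eq
    rw [OrthonormalBasis.coe_toBasis] at h2
    rw [h1, Submodule.span_image, h2, Submodule.map_top, Submodule.range_subtype]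
  have hcard : Module.finrank ℝ L + Module.finrank ℝ M =
      Fintype.card (Fin (Module.finrank ℝ L) ⊕ Fin (Module.finrank ℝ M)) := by simp
  rw [subspaceDet, if_pos h, spanVolume, hcard, euclideanHausdorffMeasure_real_parallelepiped,
    ← gramVol_comp_equiv _ (Equiv.sumComm _ _)]
  have h3 : Sum.elim l m ∘ (Equiv.sumComm (Fin (Module.finrank ℝ M)) (Fin (Module.finrank ℝ L))) =
      Sum.elim m l := by
    funext i
    rcases i with i | i <;> rfl
  rw [h3, gramVol_sumElim, gramVol_orthonormal hlo, mul_one, hspan]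

/-- The volume spanned by the projections of `m` to the orthogonal complement of `L` is a
rotation invariant of the pair `(L, m)`. -/
theorem gramVol_starProjection_rotate {ι : Type*} [Fintype ι] [DecidableEq ι]
    {N : Submodule ℝ (EuclideanSpace ℝ (Fin n))} {q : ℕ} (ρ : rotationsFixing N)
    (L : RelGrassmannian N q) (m : ι → EuclideanSpace ℝ (Fin n)) :
    gramVol (fun i => (RelGrassmannian.rotate ρ L).1ᗮ.starProjection (ρ.1.1 (m i))) =
      gramVol fun i => L.1ᗮ.starProjection (m i) := by
  have h : ∀ x, (RelGrassmannian.rotate ρ L).1ᗮ.starProjection (ρ.1.1 x) =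
      Unitary.linearIsometryEquiv ρ.1 (L.1ᗮ.starProjection x) := by
    intro x
    have h1 : (RelGrassmannian.rotate ρ L).1.starProjection (ρ.1.1 x) =
        Unitary.linearIsometryEquiv ρ.1 (L.1.starProjection
          ((Unitary.linearIsometryEquiv ρ.1).symm (Unitary.linearIsometryEquiv ρ.1 x))) :=
      Submodule.starProjection_map_apply (Unitary.linearIsometryEquiv ρ.1) L.1
        (Unitary.linearIsometryEquiv ρ.1 x)
    rw [LinearIsometryEquiv.symm_apply_apply] at h1
    rw [Submodule.starProjection_orthogonal, Submodule.starProjection_orthogonal,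
      sub_apply, h1, sub_apply, map_sub]
    rfl
  refine gramVol_congr fun i j => ?_
  rw [h, h, LinearIsometryEquiv.inner_map_map]

theorem gramVol_starProjection_smul {ι : Type*} [Fintype ι] [DecidableEq ι]
    {E : Type*} [NormedAddCommGroup E] [InnerProductSpace ℝ E] (A : E →L[ℝ] E)
    (v : ι → E) (s : ι → ℝ) (hs : ∀ i, |s i| = 1) :
    gramVol (fun i => A (s i • v i)) = gramVol fun i => A (v i) := by
  have h : (fun i => A (s i • v i)) =
      fun j => ∑ i, (Matrix.diagonal s) i j • A (v i) := by
    funext j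
    simp [Matrix.diagonal_apply]
  rw [h, gramVol_sum_smul, Matrix.det_diagonal, Finset.abs_prod]
  simp [hs]

/-- An orthonormal family extends to an orthonormal basis indexed by a disjoint sum. -/
theorem Orthonormal.exists_orthonormalBasis_sum {κ : Type*} [Fintype κ]
    {r : ℕ} {w : κ → EuclideanSpace ℝ (Fin n)} (hw : Orthonormal ℝ w)
    (h : Fintype.card κ + r = n) :
    ∃ b : OrthonormalBasis (κ ⊕ Fin r) ℝ (EuclideanSpace ℝ (Fin n)), ∀ k, b (Sum.inl k) = w k := by
  have h1 : Orthonormal ℝ ((Set.range (Sum.inl : κ → κ ⊕ Fin r)).domRestrict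
      (Sum.elim w 0)) := by
    have h2 : (Set.range (Sum.inl : κ → κ ⊕ Fin r)).domRestrict (Sum.elim w 0) =
        w ∘ (Equiv.ofInjective (Sum.inl : κ → κ ⊕ Fin r) Sum.inl_injective).symm := by
      funext ⟨x, k, hk⟩
      subst hk
      simp [Set.domRestrict]
    rw [h2]
    exact hw.comp _ (Equiv.injective _)
  obtain ⟨b, hb⟩ := h1.exists_orthonormalBasis_extension_of_card_eq (by simp [h])
  exact ⟨b, fun k => by simpa using hb (Sum.inl k) ⟨k, rfl⟩⟩

/-- Rotations fixing `u` act transitively, up to signs, on the orthonormal `p`-frames orthogonal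
to `u`. A sign is unavoidable when `p = n - 1`, because rotations have determinant one. -/
theorem exists_rotationsFixing_map_frame {p : ℕ} (hp : 1 ≤ p) (hpn : p + 1 ≤ n)
    {u : EuclideanSpace ℝ (Fin n)} (hu : ‖u‖ = 1) {e e' : Fin p → EuclideanSpace ℝ (Fin n)}
    (he : Orthonormal ℝ e) (he' : Orthonormal ℝ e')
    (heu : ∀ i, inner ℝ u (e i) = 0) (heu' : ∀ i, inner ℝ u (e' i) = 0) :
    ∃ (ρ : rotationsFixing (Submodule.span ℝ {u})) (s : Fin p → ℝ),
      (∀ i, |s i| = 1) ∧ ∀ i, ρ.1.1 (e i) = s i • e' i := by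
  have hcons : ∀ {f : Fin p → EuclideanSpace ℝ (Fin n)}, Orthonormal ℝ f →
      (∀ i, inner ℝ u (f i) = 0) → Orthonormal ℝ (Sum.elim (fun _ : Unit => u) f) := by
    intro f hf hfu
    rw [orthonormal_iff_ite]
    have hff := orthonormal_iff_ite.1 hf
    rintro (i | i) (j | j)
    · simp [hu]
    · simp [hfu]
    · simp [real_inner_comm, hfu]
    · simp [hff]
  have hcard : Fintype.card (Unit ⊕ Fin p) + (n - (p + 1)) = n := by
    simp
    omega
  obtain ⟨b, hb⟩ := (hcons he heu).exists_orthonormalBasis_sum hcard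
  obtain ⟨b', hb'⟩ := (hcons he' heu').exists_orthonormalBasis_sum hcard
  set A : EuclideanSpace ℝ (Fin n) ≃ₗᵢ[ℝ] EuclideanSpace ℝ (Fin n) :=
    b.equiv b' (Equiv.refl _) with hA
  have hAb : ∀ k, A (Sum.elim (fun _ : Unit => u) e k) = Sum.elim (fun _ : Unit => u) e' k := by
    intro k
    rw [← hb, ← hb', hA, OrthonormalBasis.equiv_apply_basis, Equiv.refl_apply]
  have hAu : A u = u := hAb (Sum.inl ())
  have hAe : ∀ i, A (e i) = e' i := fun i => hAb (Sum.inr i)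
  have key : ∀ B : EuclideanSpace ℝ (Fin n) ≃ₗᵢ[ℝ] EuclideanSpace ℝ (Fin n),
      LinearMap.det (B.toLinearEquiv : EuclideanSpace ℝ (Fin n) →ₗ[ℝ] _) = 1 → B u = u →
      ∃ ρ : rotationsFixing (Submodule.span ℝ {u}), ∀ x, ρ.1.1 x = B x := by
    intro B hdet hBu
    refine ⟨⟨Unitary.linearIsometryEquiv.symm B, hdet, fun x hx => ?_⟩, fun x => rfl⟩
    obtain ⟨c, rfl⟩ := Submodule.mem_span_singleton.1 hx
    change B (c • u) = c • u
    rw [map_smul, hBu]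
  have hdet : |LinearMap.det (A.toLinearEquiv : EuclideanSpace ℝ (Fin n) →ₗ[ℝ] _)| = 1 := by
    rw [← LinearMap.normDet_eq_abs_det]
    exact A.toLinearIsometry.normDet_eq_one
  rcases eq_or_eq_neg_of_abs_eq hdet with h1 | h1
  · obtain ⟨ρ, hρ⟩ := key A h1 hAu
    exact ⟨ρ, fun _ => 1, fun _ => abs_one, fun i => by rw [hρ, hAe, one_smul]⟩
  · -- correct the determinant by the reflection that maps one vector of the frame to its negative
    set v := e' ⟨0, hp⟩ with hv
    have hv0 : v ≠ 0 := he'.ne_zero _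
    set R := (Submodule.span ℝ {v})ᗮ.reflection with hR
    have hRdet : LinearMap.det (R.toLinearEquiv : EuclideanSpace ℝ (Fin n) →ₗ[ℝ] _) = -1 := by
      have h2 := Submodule.det_reflection (Submodule.span ℝ {v})ᗮ
      rw [Submodule.orthogonal_orthogonal, finrank_span_singleton hv0, pow_one] at h2
      exact h2
    have hRfix : ∀ x, inner ℝ v x = 0 → R x = x := fun x hx =>
      Submodule.reflection_mem_subspace_eq_self
        (Submodule.mem_orthogonal_singleton_iff_inner_right.2 hx)
    have hRe : ∀ i, R (e' i) = (if i = ⟨0, hp⟩ then -1 else 1 : ℝ) • e' i := by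
      intro i
      split_ifs with hi
      · rw [hi, neg_one_smul]
        exact Submodule.reflection_orthogonalComplement_singleton_eq_neg v
      · rw [one_smul]
        exact hRfix _ (he'.2 (Ne.symm hi))
    have hdet' : LinearMap.det
        ((A.trans R).toLinearEquiv : EuclideanSpace ℝ (Fin n) →ₗ[ℝ] _) = 1 := by
      have h3 := LinearMap.det_comp (R.toLinearEquiv : EuclideanSpace ℝ (Fin n) →ₗ[ℝ] _)
        (A.toLinearEquiv : EuclideanSpace ℝ (Fin n) →ₗ[ℝ] _)
      rw [hRdet, h1, neg_mul_neg, one_mul] at h3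
      exact h3
    have hfix : A.trans R u = u := by
      rw [LinearIsometryEquiv.trans_apply, hAu]
      exact hRfix u (by rw [real_inner_comm]; exact heu' _)
    obtain ⟨ρ, hρ⟩ := key (A.trans R) hdet' hfix
    refine ⟨ρ, fun i => if i = ⟨0, hp⟩ then -1 else 1, fun i => ?_, fun i => ?_⟩
    · change |(if i = ⟨0, hp⟩ then -1 else 1 : ℝ)| = 1
      split_ifs <;> simp
    · rw [hρ, LinearIsometryEquiv.trans_apply, hAe, hRe]

instance {N : Submodule ℝ (EuclideanSpace ℝ (Fin n))} {q : ℕ} :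
    SecondCountableTopology (RelGrassmannian N q) :=
  have : SecondCountableTopology
      (EuclideanSpace ℝ (Fin n) →L[ℝ] EuclideanSpace ℝ (Fin n)) := inferInstance
  TopologicalSpace.secondCountableTopology_induced _ _ _

theorem continuous_gramVol_starProjection_orthogonal {ι : Type*} [Fintype ι] [DecidableEq ι]
    {N : Submodule ℝ (EuclideanSpace ℝ (Fin n))} {q : ℕ} :
    Continuous fun x : RelGrassmannian N q × (ι → EuclideanSpace ℝ (Fin n)) =>
      gramVol fun i => x.1.1ᗮ.starProjection (x.2 i) := by
  have h0 : Continuous fun L : RelGrassmannian N q => L.1.starProjection :=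
    continuous_induced_dom
  refine continuous_gramVol.comp (continuous_pi fun i => ?_)
  have h1 : Continuous fun x : RelGrassmannian N q × (ι → EuclideanSpace ℝ (Fin n)) =>
      x.2 i - x.1.1.starProjection (x.2 i) := by
    have h2 : Continuous fun x : RelGrassmannian N q × (ι → EuclideanSpace ℝ (Fin n)) => x.2 i :=
      (continuous_apply i).comp continuous_snd
    exact h2.sub ((h0.comp continuous_fst).clm_apply h2)
  refine h1.congr fun x => ?_
  rw [Submodule.starProjection_orthogonal]
  rfl

/-- The mean over `L` of the `α`-th power of the volume of the projection of `m` to the orthogonal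
complement of `L`, where `L` is distributed according to the invariant measure. -/
noncomputable def projMean {N : Submodule ℝ (EuclideanSpace ℝ (Fin n))} {p q : ℕ}
    (L₀ : RelGrassmannian N q) (α : ℝ) (m : Fin p → EuclideanSpace ℝ (Fin n)) : ENNReal :=
  ∫⁻ L : RelGrassmannian N q, ENNReal.ofReal ((gramVol fun i => L.1ᗮ.starProjection (m i)) ^ α)
    ∂invariantMeasure L₀

theorem measurable_gramVol_starProjection_rpow {N : Submodule ℝ (EuclideanSpace ℝ (Fin n))}
    {p q : ℕ} (α : ℝ) :
    Measurable fun x : RelGrassmannian N q × (Fin p → EuclideanSpace ℝ (Fin n)) =>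
      ENNReal.ofReal ((gramVol fun i => x.1.1ᗮ.starProjection (x.2 i)) ^ α) :=
  (continuous_gramVol_starProjection_orthogonal.measurable.pow_const α).ennreal_ofReal

theorem projMean_rotate {N : Submodule ℝ (EuclideanSpace ℝ (Fin n))} {p q : ℕ}
    (L₀ : RelGrassmannian N q) (α : ℝ) (m : Fin p → EuclideanSpace ℝ (Fin n))
    (ρ : rotationsFixing N) : projMean L₀ α (fun i => ρ.1.1 (m i)) = projMean L₀ α m := by
  have hrot : Measurable fun L : RelGrassmannian N q => RelGrassmannian.rotate ρ L :=
    (RelGrassmannian.continuous_rotate.comp (Continuous.prodMk_right ρ)).measurable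
  unfold projMean
  conv_lhs => rw [← invariantMeasure_map_rotate L₀ ρ]
  have hmeas := (measurable_gramVol_starProjection_rpow (N := N) (q := q) α).comp
    (measurable_prodMk_right (y := fun i => ρ.1.1 (m i)))
  refine (lintegral_map hmeas hrot).trans (lintegral_congr fun L => ?_)
  exact congrArg (fun t => ENNReal.ofReal (t ^ α)) (gramVol_starProjection_rotate ρ L m)

theorem projMean_sum_smul {N : Submodule ℝ (EuclideanSpace ℝ (Fin n))} {p q : ℕ}
    (L₀ : RelGrassmannian N q) (α : ℝ) (m : Fin p → EuclideanSpace ℝ (Fin n))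
    (T : Matrix (Fin p) (Fin p) ℝ) :
    projMean L₀ α (fun j => ∑ i, T i j • m i) =
      ENNReal.ofReal (|T.det| ^ α) * projMean L₀ α m := by
  unfold projMean
  rw [← lintegral_const_mul' _ _ ENNReal.ofReal_ne_top]
  refine lintegral_congr fun L => ?_
  simp only [map_sum, map_smul]
  rw [gramVol_sum_smul, Real.mul_rpow (abs_nonneg _) (gramVol_nonneg _),
    ENNReal.ofReal_mul (Real.rpow_nonneg (abs_nonneg _) _)]

theorem projMean_eq_of_orthonormal {p q : ℕ} (hp : 1 ≤ p) (hpn : p + 1 ≤ n)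
    {u : EuclideanSpace ℝ (Fin n)} (hu : ‖u‖ = 1)
    (L₀ : RelGrassmannian (Submodule.span ℝ {u}) q) (α : ℝ)
    {e e' : Fin p → EuclideanSpace ℝ (Fin n)} (he : Orthonormal ℝ e) (he' : Orthonormal ℝ e')
    (heu : ∀ i, inner ℝ u (e i) = 0) (heu' : ∀ i, inner ℝ u (e' i) = 0) :
    projMean L₀ α e = projMean L₀ α e' := by
  obtain ⟨ρ, s, hs, hρ⟩ := exists_rotationsFixing_map_frame hp hpn hu he he' heu heu'
  rw [← projMean_rotate L₀ α e ρ]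
  unfold projMean
  simp only [hρ, gramVol_starProjection_smul _ e' s hs]

/-- The mean depends on `m` only through the volume of its projection to the orthogonal complement
of `u`: it does not see the `u`-component of `m`, is homogeneous under changes of basis, and takes
the same value `projMean L₀ α e` on all orthonormal frames orthogonal to `u`. -/
theorem projMean_eq_mul {p q : ℕ} (hp : 1 ≤ p) (hpn : p + 1 ≤ n)
    {u : EuclideanSpace ℝ (Fin n)} (hu : ‖u‖ = 1)
    (L₀ : RelGrassmannian (Submodule.span ℝ {u}) q) {α : ℝ} (hα : 0 < α)
    {e : Fin p → EuclideanSpace ℝ (Fin n)} (he : Orthonormal ℝ e)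
    (heu : ∀ i, inner ℝ u (e i) = 0) (m : Fin p → EuclideanSpace ℝ (Fin n)) :
    projMean L₀ α m = projMean L₀ α e *
      ENNReal.ofReal ((gramVol fun i => (Submodule.span ℝ {u})ᗮ.starProjection (m i)) ^ α) := by
  set m' : Fin p → EuclideanSpace ℝ (Fin n) :=
    fun i => (Submodule.span ℝ {u})ᗮ.starProjection (m i) with hm'
  have hmm' : projMean L₀ α m = projMean L₀ α m' := by
    unfold projMean
    refine lintegral_congr fun L => ?_
    have h : ∀ x, L.1ᗮ.starProjection ((Submodule.span ℝ {u})ᗮ.starProjection x) =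
        L.1ᗮ.starProjection x := fun x =>
      DFunLike.congr_fun (Submodule.starProjection_comp_starProjection_of_le
        (Submodule.orthogonal_le L.2.1)) x
    simp only [hm', h]
  rw [hmm']
  by_cases hli : LinearIndependent ℝ m'
  · set S := Submodule.span ℝ (Set.range m') with hS
    have hSdim : Module.finrank ℝ S = p := by simpa using finrank_span_eq_card hli
    set b : OrthonormalBasis (Fin p) ℝ S :=
      (stdOrthonormalBasis ℝ S).reindex (finCongr hSdim) with hb
    have hmem : ∀ j, m' j ∈ S := fun j => Submodule.subset_span (Set.mem_range_self j)
    have hbo : Orthonormal ℝ fun i => (b i : EuclideanSpace ℝ (Fin n)) :=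
      b.orthonormal.comp_linearIsometry S.subtypeₗᵢ
    have hSu : S ≤ (Submodule.span ℝ {u})ᗮ := by
      rw [hS, Submodule.span_le]
      rintro _ ⟨i, rfl⟩
      exact Submodule.starProjection_apply_mem _ _
    have hbu : ∀ i, inner ℝ u (b i : EuclideanSpace ℝ (Fin n)) = 0 := fun i =>
      Submodule.mem_orthogonal_singleton_iff_inner_right.1 (hSu (b i).2)
    set T : Matrix (Fin p) (Fin p) ℝ := Matrix.of fun i j => b.repr ⟨m' j, hmem j⟩ i with hT
    have hTm : m' = fun j => ∑ i, T i j • (b i : EuclideanSpace ℝ (Fin n)) := by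
      funext j
      have h := congrArg (Subtype.val) (b.sum_repr ⟨m' j, hmem j⟩)
      simpa [hT] using h.symm
    rw [hTm, projMean_sum_smul, gramVol_sum_smul, gramVol_orthonormal hbo, mul_one, mul_comm,
      projMean_eq_of_orthonormal hp hpn hu L₀ α hbo he hbu heu]
  · have h1 : gramVol m' = 0 := by
      by_contra h
      exact hli (gramVol_ne_zero_iff.1 h)
    have h2 : ∀ L : RelGrassmannian (Submodule.span ℝ {u}) q,
        gramVol (fun i => L.1ᗮ.starProjection (m' i)) = 0 := by
      intro L
      by_contra h
      exact hli ((gramVol_ne_zero_iff.1 h).of_comp L.1ᗮ.starProjection.toLinearMap)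
    unfold projMean
    simp only [h1, h2, Real.zero_rpow hα.ne', ENNReal.ofReal_zero, lintegral_zero, mul_zero]

/-- The constant `a(n, p, q, α)` is a quotient of products of Gaussian moments; the powers of `2`
cancel, and the index is shifted by one. -/
theorem prod_gaussianNormMoment_eq_aConst_mul {p q : ℕ} {α : ℝ} (hα : 0 ≤ α) (hq : 1 ≤ q)
    (hpq : p + q ≤ n) :
    ∏ i ∈ Finset.range p, gaussianNormMoment α ((n : ℝ) - q - i) =
      aConst n p q α * ∏ i ∈ Finset.range p, gaussianNormMoment α ((n : ℝ) - 1 - i) := by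
  have hIcc : Finset.Icc 1 p = Finset.Ico (0 + 1) (p + 1) := by
    ext i
    simp
  rw [aConst, hIcc, ← Finset.prod_Ico_add', ← Finset.range_eq_Ico, ← Finset.prod_mul_distrib]
  refine Finset.prod_congr rfl fun i hi => ?_
  have hi' : i + 1 ≤ p := Finset.mem_range.1 hi
  have hd1 : (1 : ℝ) ≤ n - q - i := by
    have : ((i + 1 + q : ℕ) : ℝ) ≤ n := by exact_mod_cast (by omega : i + 1 + q ≤ n)
    push_cast at this
    linarith
  have hq1 : (1 : ℝ) ≤ q := by exact_mod_cast hq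
  have hG : ∀ x : ℝ, 0 < x → Real.Gamma (x / 2) ≠ 0 := fun x hx =>
    (Real.Gamma_pos_of_pos (by positivity)).ne'
  have g1 := hG ((n : ℝ) - 1 - i) (by linarith)
  have g2 := hG ((n : ℝ) - 1 - i + α) (by linarith)
  have g3 := hG ((n : ℝ) - q - i) (by linarith)
  push_cast
  rw [show (n : ℝ) - (i + 1) = n - 1 - i by ring,
    show (n : ℝ) - q - (i + 1) + α + 1 = n - q - i + α by ring,
    show (n : ℝ) - q - (i + 1) + 1 = n - q - i by ring]
  unfold gaussianNormMoment
  field_simp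

/-- Averaging `projMean_eq_mul` over independent Gaussian vectors `m` and exchanging the order of
integration identifies the value on orthonormal frames. -/
theorem projMean_orthonormal {p q : ℕ} (hp : 1 ≤ p) (hq : 1 ≤ q) (hpq : p + q ≤ n)
    {u : EuclideanSpace ℝ (Fin n)} (hu : ‖u‖ = 1)
    (L₀ : RelGrassmannian (Submodule.span ℝ {u}) q) {α : ℝ} (hα : 0 < α)
    {e : Fin p → EuclideanSpace ℝ (Fin n)} (he : Orthonormal ℝ e)
    (heu : ∀ i, inner ℝ u (e i) = 0) :
    projMean L₀ α e = ENNReal.ofReal (aConst n p q α) := by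
  have hu0 : u ≠ 0 := fun h => by simp [h] at hu
  set γ : Measure (Fin p → EuclideanSpace ℝ (Fin n)) :=
    Measure.pi fun _ => stdGaussian (EuclideanSpace ℝ (Fin n)) with hγ
  have hdim : ∀ L : RelGrassmannian (Submodule.span ℝ {u}) q,
      Module.finrank ℝ (L.1ᗮ : Submodule ℝ (EuclideanSpace ℝ (Fin n))) + q = n := by
    intro L
    have h := L.1.finrank_add_finrank_orthogonal
    rw [L.2.2, finrank_euclideanSpace_fin] at h
    omega
  have hdimu : Module.finrank ℝ
      ((Submodule.span ℝ {u})ᗮ : Submodule ℝ (EuclideanSpace ℝ (Fin n))) + 1 = n := by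
    have h := (Submodule.span ℝ {u}).finrank_add_finrank_orthogonal
    rw [finrank_span_singleton hu0, finrank_euclideanSpace_fin] at h
    omega
  have h1 : ∫⁻ m, projMean L₀ α m ∂γ = projMean L₀ α e * ENNReal.ofReal
      (∏ i ∈ Finset.range p, gaussianNormMoment α ((n : ℝ) - 1 - i)) := by
    rw [lintegral_congr (projMean_eq_mul hp (by omega) hu L₀ hα he heu), lintegral_const_mul]
    · rw [hγ, lintegral_gramVol_starProjection_pi_stdGaussian hα _ _ (by omega)]
      congr 3
      funext i
      congr 2
      rw [eq_sub_iff_add_eq]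
      exact_mod_cast hdimu
    · exact ((continuous_gramVol.comp (continuous_pi fun i => by
        fun_prop)).measurable.pow_const α).ennreal_ofReal
  have h2 : ∫⁻ m, projMean L₀ α m ∂γ = ENNReal.ofReal
      (∏ i ∈ Finset.range p, gaussianNormMoment α ((n : ℝ) - q - i)) := by
    unfold projMean
    rw [lintegral_lintegral_swap]
    · have h3 : ∀ L : RelGrassmannian (Submodule.span ℝ {u}) q,
          ∫⁻ m, ENNReal.ofReal ((gramVol fun i => L.1ᗮ.starProjection (m i)) ^ α) ∂γ =
          ENNReal.ofReal (∏ i ∈ Finset.range p, gaussianNormMoment α ((n : ℝ) - q - i)) := by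
        intro L
        have hL := hdim L
        rw [hγ, lintegral_gramVol_starProjection_pi_stdGaussian hα _ _ (by omega)]
        congr 2
        funext i
        congr 2
        rw [eq_sub_iff_add_eq]
        exact_mod_cast hL
      rw [lintegral_congr h3, lintegral_const, measure_univ, mul_one]
    · exact ((measurable_gramVol_starProjection_rpow α).comp measurable_swap).aemeasurable
  have hpos : 0 < ∏ i ∈ Finset.range p, gaussianNormMoment α ((n : ℝ) - 1 - i) := by
    refine Finset.prod_pos fun i hi => gaussianNormMoment_pos hα.le ?_
    have hi' : i + 1 ≤ p := Finset.mem_range.1 hi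
    have : ((1 + i + 1 : ℕ) : ℝ) ≤ n := by exact_mod_cast (by omega : 1 + i + 1 ≤ n)
    push_cast at this
    linarith
  rw [h1, prod_gaussianNormMoment_eq_aConst_mul hα.le hq hpq, ENNReal.ofReal_mul' hpos.le] at h2
  exact (ENNReal.mul_left_inj (ENNReal.ofReal_pos.2 hpos).ne' ENNReal.ofReal_ne_top).1 h2

theorem aConst_nonneg {p q : ℕ} {α : ℝ} (hα : 0 ≤ α) (hpq : p + q ≤ n) (hq : 1 ≤ q) :
    0 ≤ aConst n p q α := by
  refine Finset.prod_nonneg fun i hi => ?_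
  have hi' := (Finset.mem_Icc.1 hi).2
  have h1 : ((i + q : ℕ) : ℝ) ≤ n := by exact_mod_cast (by omega : i + q ≤ n)
  have h2 : (1 : ℝ) ≤ q := by exact_mod_cast hq
  push_cast at h1
  have hG : ∀ x : ℝ, 0 < x → 0 < Real.Gamma (x / 2) := fun x hx =>
    Real.Gamma_pos_of_pos (by positivity)
  have g1 := hG ((n : ℝ) - i) (by linarith)
  have g2 := hG ((n : ℝ) - q - i + α + 1) (by linarith)
  have g3 := hG ((n : ℝ) - i + α) (by linarith)
  have g4 := hG ((n : ℝ) - q - i + 1) (by linarith)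
  positivity

theorem aConst_zero {p q : ℕ} (hpq : p + q ≤ n) (hq : 1 ≤ q) : aConst n p q 0 = 1 := by
  refine Finset.prod_eq_one fun i hi => ?_
  have hi' := (Finset.mem_Icc.1 hi).2
  have h1 : ((i + q : ℕ) : ℝ) ≤ n := by exact_mod_cast (by omega : i + q ≤ n)
  have h2 : (1 : ℝ) ≤ q := by exact_mod_cast hq
  push_cast at h1
  have hG : ∀ x : ℝ, 0 < x → 0 < Real.Gamma (x / 2) := fun x hx =>
    Real.Gamma_pos_of_pos (by positivity)
  have g1 := hG ((n : ℝ) - i) (by linarith)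
  have g4 := hG ((n : ℝ) - q - i + 1) (by linarith)
  rw [add_zero, add_zero]
  exact div_self (mul_pos g1 g4).ne'

end Grassmannian

theorem lemma3p2 (n p q : ℕ) (α : ℝ) (hn : 2 ≤ n) (hα : 0 ≤ α)
    (hp : 1 ≤ p) (hp' : p ≤ n - 1) (hq : 1 ≤ q) (hq' : q ≤ n - 1) (hpq : p + q ≤ n)
    (u : EuclideanSpace ℝ (Fin n)) (hu : ‖u‖ = 1)
    (M : Submodule ℝ (EuclideanSpace ℝ (Fin n))) (hM : Module.finrank ℝ M = p)
    (L₀ : RelGrassmannian (Submodule.span ℝ {u}) q) :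
    MeasureTheory.Integrable
        (fun L : RelGrassmannian (Submodule.span ℝ {u}) q => subspaceDet L.1 M ^ α)
        (invariantMeasure L₀) ∧
      ∫ L : RelGrassmannian (Submodule.span ℝ {u}) q, subspaceDet L.1 M ^ α
          ∂(invariantMeasure L₀) =
        aConst n p q α * subspaceDet (Submodule.span ℝ {u}) M ^ α := by
  subst hM
  rcases hα.eq_or_lt with rfl | hα'
  -- `x ^ 0 = 1` also for `x = 0`, so both sides are `1`
  · simp [aConst_zero hpq hq]
  have hu0 : u ≠ 0 := fun h => by simp [h] at hu
  set m : Fin (Module.finrank ℝ M) → EuclideanSpace ℝ (Fin n) :=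
    fun i => (stdOrthonormalBasis ℝ M i : EuclideanSpace ℝ (Fin n)) with hm
  have hdet : ∀ L : RelGrassmannian (Submodule.span ℝ {u}) q,
      subspaceDet L.1 M = gramVol fun i => L.1ᗮ.starProjection (m i) := fun L =>
    subspaceDet_eq_gramVol L.1 M (by rw [L.2.2]; omega)
  have hdetu : subspaceDet (Submodule.span ℝ {u}) M =
      gramVol fun i => (Submodule.span ℝ {u})ᗮ.starProjection (m i) :=
    subspaceDet_eq_gramVol _ M (by rw [finrank_span_singleton hu0]; omega)
  -- an orthonormal frame orthogonal to `u`
  have hdimu : Module.finrank ℝ M ≤ Module.finrank ℝ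
      ((Submodule.span ℝ {u})ᗮ : Submodule ℝ (EuclideanSpace ℝ (Fin n))) := by
    have h := (Submodule.span ℝ {u}).finrank_add_finrank_orthogonal
    rw [finrank_span_singleton hu0, finrank_euclideanSpace_fin] at h
    omega
  set e : Fin (Module.finrank ℝ M) → EuclideanSpace ℝ (Fin n) := fun i =>
    (stdOrthonormalBasis ℝ (Submodule.span ℝ {u})ᗮ (Fin.castLE hdimu i) : _) with he
  have heo : Orthonormal ℝ e :=
    ((stdOrthonormalBasis ℝ _).orthonormal.comp _ (Fin.castLE_injective hdimu)).comp_linearIsometry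
      (Submodule.span ℝ {u})ᗮ.subtypeₗᵢ
  have heu : ∀ i, inner ℝ u (e i) = 0 := fun i =>
    Submodule.mem_orthogonal_singleton_iff_inner_right.1 (Subtype.property _)
  have hmean : projMean L₀ α m = ENNReal.ofReal (aConst n (Module.finrank ℝ M) q α *
      subspaceDet (Submodule.span ℝ {u}) M ^ α) := by
    rw [projMean_eq_mul hp (by omega) hu L₀ hα' heo heu m,
      projMean_orthonormal hp hq hpq hu L₀ hα' heo heu, hdetu,
      ENNReal.ofReal_mul (aConst_nonneg hα hpq hq)]
  have hnn : 0 ≤ aConst n (Module.finrank ℝ M) q α * subspaceDet (Submodule.span ℝ {u}) M ^ α := by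
    rw [hdetu]
    exact mul_nonneg (aConst_nonneg hα hpq hq) (Real.rpow_nonneg (gramVol_nonneg _) _)
  simp only [hdet]
  have hmeas : Measurable fun L : RelGrassmannian (Submodule.span ℝ {u}) q =>
      (gramVol fun i => L.1ᗮ.starProjection (m i)) ^ α :=
    (continuous_gramVol_starProjection_orthogonal.comp
      (Continuous.prodMk_left m)).measurable.pow_const α
  have hpos : ∀ L : RelGrassmannian (Submodule.span ℝ {u}) q,
      0 ≤ (gramVol fun i => L.1ᗮ.starProjection (m i)) ^ α := fun L =>
    Real.rpow_nonneg (gramVol_nonneg _) _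
  have hint : ∫⁻ L : RelGrassmannian (Submodule.span ℝ {u}) q,
      ENNReal.ofReal ((gramVol fun i => L.1ᗮ.starProjection (m i)) ^ α) ∂invariantMeasure L₀ =
      ENNReal.ofReal (aConst n (Module.finrank ℝ M) q α *
        subspaceDet (Submodule.span ℝ {u}) M ^ α) := hmean
  constructor
  · refine ⟨hmeas.aestronglyMeasurable, ?_⟩
    rw [hasFiniteIntegral_iff_ofReal (.of_forall hpos), hint]
    exact ENNReal.ofReal_lt_top
  · rw [integral_eq_lintegral_of_nonneg_ae (.of_forall hpos) hmeas.aestronglyMeasurable, hint,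
      ENNReal.toReal_ofReal hnn]
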